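/- For each $n\ge 1$ let $A$ be an $m_1\times n$ and $B$ an $m_2\times n$ random matrix, all entries of $A$ and $B$ together being i.i.d. standard normal, where $m_1=m_1(n)$, $m_2=m_2(n)$ satisfy $m_1/n\to\alpha_1$ and $m_2/n\to\alpha_2$ as $n\to\infty$, for constants $\alpha_1,\alpha_2\ge 0$ (for instance $m_1=\alpha_1 n$, $m_2=\alpha_2 n$). Put $$\xi_h=\min\Big\{\sum_{i=1}^n x_i : x\in\mathbb R^n,\ Ax=0,\ Bx\le 0,\ \|x\|_2\le 1\Big\}.$$ For $\epsilon_1,\epsilon_5>0$ independent of $n$ let $d_l=(1-\epsilon_1)\sqrt{\alpha_1+\alpha_2/2}-\epsilon_5$, $d_u=(1+\epsilon_1)\sqrt{\alpha_1+\alpha_2/2}+\epsilon_5$, and $$\xi_D^{(l)}=\begin{cases}-\sqrt{1-d_l^2}\,\sqrt n,& d_l^2\le 1\\ 0,&\text{otherwise,}\end{cases}\qquad \xi_D^{(u)}=\begin{cases}-\sqrt{1-d_u^2}\,\sqrt n,& d_u^2\le 1\\ 0,&\text{otherwise.}\end{cases}$$ (a) Let $\epsilon_1,\epsilon_5>0$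 be small enough that $d_l\ge 0$. Then $\lim_{n\to\infty}P(\xi_D^{(l)}\le\xi_h\le\xi_D^{(u)})=1$. If $d_l<1$, then moreover $\lim_{n\to\infty}P(\xi_D^{(l)}<\xi_h\le\xi_D^{(u)})=1$. If $\alpha_1+\alpha_2/2<1$, then moreover $\lim_{n\to\infty}P(\xi_D^{(l)}<\xi_h<\xi_D^{(u)})=1$. (b) If $\alpha_1+\alpha_2/2<1$, then for every $\delta>0$, $\lim_{n\to\infty}P\big(|\xi_h+\sqrt{1-\alpha_1-\alpha_2/2}\,\sqrt n|\le\delta\sqrt n\big)=1$. If $\alpha_1+\alpha_2/2\ge 1$, then for every $\delta>0$, $\lim_{n\to\infty}P(|\xi_h|\le\delta\sqrt n)=1$. If $\alpha_1+\alpha_2/2>1$, then $\lim_{n\to\infty}P(\xi_h=0)=1$. -/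

import Mathlib

open MeasureTheory ProbabilityTheory Filter Topology
open scoped Matrix

noncomputable section

namespace RandomLinearProgram

/-- The feasible set `A x = 0`, `B x ≤ 0` (componentwise), `‖x‖₂ ≤ 1`. -/
def feasible {m₁ m₂ n : ℕ} (A : Matrix (Fin m₁) (Fin n) ℝ) (B : Matrix (Fin m₂) (Fin n) ℝ) :
    Set (EuclideanSpace ℝ (Fin n)) :=
  {x | A *ᵥ x.ofLp = 0 ∧ (∀ i, (B *ᵥ x.ofLp) i ≤ 0) ∧ ‖x‖ ≤ 1}

/-- The optimal value of `min f(x)` over the feasible set. For the linear objective below it is an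
attained minimum, see `isLeast_xiH`. -/
def xiH {m₁ m₂ n : ℕ} (f : EuclideanSpace ℝ (Fin n) → ℝ)
    (A : Matrix (Fin m₁) (Fin n) ℝ) (B : Matrix (Fin m₂) (Fin n) ℝ) : ℝ :=
  sInf (f '' feasible A B)

/-- The purely linear objective `∑ xᵢ`. -/
def fLp {n : ℕ} (x : EuclideanSpace ℝ (Fin n)) : ℝ := ∑ i, x i

theorem isLeast_xiH {m₁ m₂ n : ℕ} (A : Matrix (Fin m₁) (Fin n) ℝ)
    (B : Matrix (Fin m₂) (Fin n) ℝ) : IsLeast (fLp '' feasible A B) (xiH fLp A B) := by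
  have hc : IsCompact (feasible A B) := by
    refine (isCompact_closedBall (0 : EuclideanSpace ℝ (Fin n)) 1).of_isClosed_subset ?_ ?_
    · have h1 : Continuous fun x : EuclideanSpace ℝ (Fin n) => A *ᵥ x.ofLp := by fun_prop
      have h2 : Continuous fun x : EuclideanSpace ℝ (Fin n) => B *ᵥ x.ofLp := by fun_prop
      have h3 : IsClosed {x : EuclideanSpace ℝ (Fin n) | ∀ i, (B *ᵥ x.ofLp) i ≤ 0} := by
        simp only [Set.ofPred_forall]
        exact isClosed_iInter fun i =>
          isClosed_le ((continuous_apply i).comp h2) continuous_const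
      exact (isClosed_eq h1 continuous_const).inter
        (h3.inter (isClosed_le continuous_norm continuous_const))
    · intro x hx
      simpa using hx.2.2
  have hf : Continuous (fLp : EuclideanSpace ℝ (Fin n) → ℝ) := by
    unfold fLp
    fun_prop
  exact (hc.image hf).isLeast_sInf ⟨fLp 0, 0, by simp [feasible], rfl⟩

/-- `√D⁽ˡ⁾ = (1 - ε₁) √(α₁ + α₂/2) - ε₅`. -/
def sqrtDl (ε₁ ε₅ α₁ α₂ : ℝ) : ℝ := (1 - ε₁) * √(α₁ + α₂ / 2) - ε₅

/-- `√D⁽ᵘ⁾ = (1 + ε₁) √(α₁ + α₂/2) + ε₅`. -/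
def sqrtDu (ε₁ ε₅ α₁ α₂ : ℝ) : ℝ := (1 + ε₁) * √(α₁ + α₂ / 2) + ε₅

/-- The lower bound `ξ_D⁽ˡ⁾`. -/
def xiDl (ε₁ ε₅ α₁ α₂ : ℝ) (n : ℕ) : ℝ :=
  if sqrtDl ε₁ ε₅ α₁ α₂ ^ 2 ≤ 1 then -√(1 - sqrtDl ε₁ ε₅ α₁ α₂ ^ 2) * √n else 0

/-- The upper bound `ξ_D⁽ᵘ⁾`. -/
def xiDu (ε₁ ε₅ α₁ α₂ : ℝ) (n : ℕ) : ℝ :=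
  if sqrtDu ε₁ ε₅ α₁ α₂ ^ 2 ≤ 1 then -√(1 - sqrtDu ε₁ ε₅ α₁ α₂ ^ 2) * √n else 0

/-- All entries of the two random matrices `A` and `B` together form an independent family of
standard normal random variables. -/
structure IsIIDStdGaussian {Ω : Type*} [MeasurableSpace Ω] (μ : Measure Ω) {m₁ m₂ n : ℕ}
    (A : Ω → Matrix (Fin m₁) (Fin n) ℝ) (B : Ω → Matrix (Fin m₂) (Fin n) ℝ) : Prop where
  hasLaw : ∀ p : (Fin m₁ ⊕ Fin m₂) × Fin n,
    HasLaw (fun ω => Matrix.fromRows (A ω) (B ω) p.1 p.2) (gaussianReal 0 1) μ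
  indep : iIndepFun (fun (p : (Fin m₁ ⊕ Fin m₂) × Fin n) (ω : Ω) =>
    Matrix.fromRows (A ω) (B ω) p.1 p.2) μ

end RandomLinearProgram

end

/-!
Minimizing the coordinate sum over a cone intersected with the unit ball gives minus the norm of
the point `x` of the cone nearest to `v = (-1, …, -1)`, so everything reduces to the size of `x`
for the random polyhedral cone `A x = 0`, `B x ≤ 0`.

Reversing inequalities and changing signs of coordinates preserves the Gaussian law, so one may
average over all `2 ^ m₂` ways to direct the inequalities and over all `v ∈ {-1, 1} ^ n`. For fixed
rows, the nearest points to the `2 ^ m₂` cones are, up to order, the projections of `v` onto the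
subspaces orthogonal to the rows of `A` and to a subset `S` of the rows of `B`: each added
hyperplane replaces the nearest point to a set by the nearest points to that set and to the
cut. In general position such a subspace has dimension `n - m₁ - |S|`, truncated at `0`. The
squared norm of the projection of a random sign vector concentrates around this dimension, and the
size of a random subset `S` around `m₂ / 2`, both with variance `O(n)`. By Chebyshev's inequality
`‖x‖ ^ 2` is `max 0 (n - m₁ - m₂ / 2)` up to `o(n)`, and if `m₁ + m₂ / 2` exceeds `n` by a multiple
of `n`, then all but a small fraction of the subspaces are zero.
-/

noncomputable section

namespace RandomLinearProgram

open scoped RealInnerProductSpace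

section SignPattern

variable {κ : Type*} [DecidableEq κ] {P U : Finset κ} {j k : κ}

/-- The sign pattern that is `1` on `P` and `-1` off `P`. Sums over sign patterns thus become sums
over finite sets. -/
def sgn (P : Finset κ) (k : κ) : ℝ := if k ∈ P then 1 else -1

theorem sgn_of_mem (h : k ∈ P) : sgn P k = 1 := if_pos h

theorem sgn_of_notMem (h : k ∉ P) : sgn P k = -1 := if_neg h

theorem sgn_insert_of_ne (P : Finset κ) (h : j ≠ k) : sgn (insert k P) j = sgn P j := by
  simp [sgn, h]

theorem sgn_mul_self (P : Finset κ) (k : κ) : sgn P k * sgn P k = 1 := by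
  by_cases h : k ∈ P
  · simp [sgn_of_mem h]
  · simp [sgn_of_notMem h]

theorem sum_sgn_insert_mul (hk : k ∉ U) (P : Finset κ) (c : κ → ℝ) :
    ∑ j ∈ U, sgn (insert k P) j * c j = ∑ j ∈ U, sgn P j * c j :=
  Finset.sum_congr rfl fun j hj => by rw [sgn_insert_of_ne P (ne_of_mem_of_not_mem hj hk)]

theorem sum_powerset_sq_sum_sgn_mul (U : Finset κ) (c : κ → ℝ) :
    ∑ P ∈ U.powerset, (∑ j ∈ U, sgn P j * c j) ^ 2 = 2 ^ U.card * ∑ j ∈ U, c j ^ 2 := by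
  induction U using Finset.induction_on with
  | empty => simp
  | insert k U hk ih =>
    have hstep : ∀ P ∈ U.powerset, (∑ j ∈ insert k U, sgn P j * c j) ^ 2 +
        (∑ j ∈ insert k U, sgn (insert k P) j * c j) ^ 2 =
          2 * (∑ j ∈ U, sgn P j * c j) ^ 2 + 2 * c k ^ 2 := fun P hP => by
      rw [Finset.sum_insert hk, Finset.sum_insert hk, sum_sgn_insert_mul hk,
        sgn_of_mem (Finset.mem_insert_self k P),
        sgn_of_notMem fun h => hk (Finset.mem_powerset.1 hP h)]
      ring
    rw [Finset.sum_powerset_insert hk, ← Finset.sum_add_distrib, Finset.sum_congr rfl hstep,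
      Finset.sum_add_distrib, ← Finset.mul_sum, ih, Finset.sum_insert hk,
      Finset.card_insert_of_notMem hk, Finset.sum_const, Finset.card_powerset, nsmul_eq_mul]
    push_cast
    ring

theorem sum_sgn_eq_two_mul_card_sub (hPU : P ⊆ U) :
    ∑ j ∈ U, sgn P j = 2 * P.card - U.card := by
  have h : ∀ j, sgn P j = 2 * (if j ∈ P then 1 else 0) - 1 := fun j => by
    rw [sgn]
    split_ifs <;> norm_num
  simp only [h, Finset.sum_sub_distrib, ← Finset.mul_sum, Finset.sum_ite_mem,
    Finset.inter_eq_right.2 hPU]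
  simp

theorem sum_powerset_card_sub_half_sq {κ : Type*} (U : Finset κ) :
    ∑ P ∈ U.powerset, ((P.card : ℝ) - U.card / 2) ^ 2 = (2 : ℝ) ^ U.card * (U.card / 4) := by
  classical
  have h : ∀ P ∈ U.powerset,
      ((P.card : ℝ) - U.card / 2) ^ 2 = (∑ j ∈ U, sgn P j * (1 / 2)) ^ 2 := fun P hP => by
    rw [← Finset.sum_mul, sum_sgn_eq_two_mul_card_sub (Finset.mem_powerset.1 hP)]
    ring
  rw [Finset.sum_congr rfl h, sum_powerset_sq_sum_sgn_mul, Finset.sum_const, nsmul_eq_mul]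
  ring

/-- The quadratic form of `Q` on the coordinates in `U`, evaluated at a sign pattern and centered
at its mean, the trace of `Q`. -/
def centeredQuadForm (Q : κ → κ → ℝ) (U P : Finset κ) : ℝ :=
  ∑ i ∈ U, ∑ j ∈ U, Q i j * (sgn P i * sgn P j) - ∑ i ∈ U, Q i i

theorem centeredQuadForm_insert {Q : κ → κ → ℝ} (hQ : ∀ i j, Q i j = Q j i) (hk : k ∉ U)
    (P : Finset κ) :
    centeredQuadForm Q (insert k U) P =
      centeredQuadForm Q U P + sgn P k * (2 * ∑ j ∈ U, sgn P j * Q k j) := by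
  simp only [centeredQuadForm, Finset.sum_insert hk, Finset.sum_add_distrib, Finset.mul_sum]
  have hcol : ∑ i ∈ U, Q i k * (sgn P i * sgn P k) = ∑ j ∈ U, Q k j * (sgn P k * sgn P j) :=
    Finset.sum_congr rfl fun i _ => by rw [hQ i k]; ring
  have hdouble : ∑ j ∈ U, sgn P k * (2 * (sgn P j * Q k j)) =
      2 * ∑ j ∈ U, Q k j * (sgn P k * sgn P j) := by
    rw [Finset.mul_sum]
    exact Finset.sum_congr rfl fun j _ => by ring
  rw [hcol, hdouble, sgn_mul_self]
  ring

theorem centeredQuadForm_insert_right (Q : κ → κ → ℝ) (hk : k ∉ U) (P : Finset κ) :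
    centeredQuadForm Q U (insert k P) = centeredQuadForm Q U P := by
  have h : ∀ j ∈ U, sgn (insert k P) j = sgn P j :=
    fun j hj => sgn_insert_of_ne P (ne_of_mem_of_not_mem hj hk)
  simp only [centeredQuadForm]
  congr 1
  exact Finset.sum_congr rfl fun i hi => Finset.sum_congr rfl fun j hj => by rw [h i hi, h j hj]

theorem sum_powerset_centeredQuadForm_sq_le {Q : κ → κ → ℝ} (hQ : ∀ i j, Q i j = Q j i)
    (U : Finset κ) :
    ∑ P ∈ U.powerset, centeredQuadForm Q U P ^ 2 ≤
      2 ^ U.card * (2 * ∑ i ∈ U, ∑ j ∈ U, Q i j ^ 2) := by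
  induction U using Finset.induction_on with
  | empty => simp [centeredQuadForm]
  | insert k U hk ih =>
    have hstep : ∀ P ∈ U.powerset, centeredQuadForm Q (insert k U) P ^ 2 +
        centeredQuadForm Q (insert k U) (insert k P) ^ 2 =
          2 * centeredQuadForm Q U P ^ 2 + 8 * (∑ j ∈ U, sgn P j * Q k j) ^ 2 := fun P hP => by
      rw [centeredQuadForm_insert hQ hk, centeredQuadForm_insert hQ hk,
        centeredQuadForm_insert_right Q hk, sum_sgn_insert_mul hk,
        sgn_of_mem (Finset.mem_insert_self k P),
        sgn_of_notMem fun h => hk (Finset.mem_powerset.1 hP h)]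
      ring
    have hsq : 2 * (∑ j ∈ U, Q k j ^ 2) + ∑ i ∈ U, ∑ j ∈ U, Q i j ^ 2 ≤
        ∑ i ∈ insert k U, ∑ j ∈ insert k U, Q i j ^ 2 := by
      simp only [Finset.sum_insert hk, Finset.sum_add_distrib, hQ _ k]
      nlinarith [sq_nonneg (Q k k)]
    rw [Finset.sum_powerset_insert hk, ← Finset.sum_add_distrib, Finset.sum_congr rfl hstep,
      Finset.sum_add_distrib, ← Finset.mul_sum, ← Finset.mul_sum, sum_powerset_sq_sum_sgn_mul,
      Finset.card_insert_of_notMem hk, pow_succ]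
    have hpow : (0 : ℝ) ≤ 2 ^ U.card := by positivity
    nlinarith [mul_le_mul_of_nonneg_left hsq hpow]

end SignPattern

section NearestPoint

variable {E : Type*} [NormedAddCommGroup E] [InnerProductSpace ℝ E] {C D : Set E} {a v x y : E}

/-- `x` is the point of the convex set `C` nearest to `v`, encoded by the variational inequality
that characterizes it. -/
structure IsNearestPoint (C : Set E) (v x : E) : Prop where
  mem : x ∈ C
  inner_le : ∀ y ∈ C, ⟪v - x, y - x⟫ ≤ 0

/-- The closed half-space with outer normal `a` whose boundary passes through the origin. -/
def halfSpace (a : E) : Set E := {y | ⟪a, y⟫ ≤ 0}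

theorem mem_halfSpace : y ∈ halfSpace a ↔ ⟪a, y⟫ ≤ 0 := Iff.rfl

theorem mem_halfSpace_neg : y ∈ halfSpace (-a) ↔ 0 ≤ ⟪a, y⟫ := by simp [mem_halfSpace]

theorem zero_mem_halfSpace (a : E) : 0 ∈ halfSpace a := by simp [mem_halfSpace]

theorem isClosed_halfSpace (a : E) : IsClosed (halfSpace a) :=
  isClosed_le (by fun_prop) continuous_const

theorem convex_halfSpace (a : E) : Convex ℝ (halfSpace a) :=
  convex_halfSpace_le (innerₛₗ ℝ a).isLinear 0

namespace IsNearestPoint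

theorem unique (hx : IsNearestPoint C v x) (hy : IsNearestPoint C v y) : x = y := by
  have h : ⟪y - x, y - x⟫ = ⟪v - x, y - x⟫ + ⟪v - y, x - y⟫ := by
    simp only [inner_sub_left, inner_sub_right]; ring
  have h0 : ⟪y - x, y - x⟫ ≤ 0 :=
    h.trans_le (add_nonpos (hx.inner_le y hy.mem) (hy.inner_le x hx.mem))
  exact (sub_eq_zero.mp (real_inner_self_nonpos.mp h0)).symm

theorem mono (hx : IsNearestPoint C v x) (hDC : D ⊆ C) (hxD : x ∈ D) : IsNearestPoint D v x :=
  ⟨hxD, fun y hy => hx.inner_le y (hDC hy)⟩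

/-- The constraint is active at `y`, since otherwise `y` could be moved towards `x`. -/
theorem inner_eq_zero_of_inter_halfSpace_neg (hC : Convex ℝ C) (hx : IsNearestPoint C v x)
    (hax : x ∈ halfSpace a) (hy : IsNearestPoint (C ∩ halfSpace (-a)) v y) : ⟪a, y⟫ = 0 := by
  rw [mem_halfSpace] at hax
  by_contra hne
  have hay : 0 < ⟪a, y⟫ := lt_of_le_of_ne (mem_halfSpace_neg.1 hy.mem.2) (Ne.symm hne)
  have hden : 0 < ⟪a, y⟫ - ⟪a, x⟫ := by linarith
  set t : ℝ := ⟪a, y⟫ / (⟪a, y⟫ - ⟪a, x⟫) with ht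
  have ht0 : 0 < t := div_pos hay hden
  have ht1 : t ≤ 1 := (div_le_one hden).2 (by linarith)
  have hz : ⟪a, y + t • (x - y)⟫ = 0 := by
    rw [inner_add_right, inner_smul_right, inner_sub_right, ht]
    field_simp
    ring
  have hyx : ⟪v - y, x - y⟫ ≤ 0 := by
    have h := hy.inner_le _ ⟨hC.add_smul_sub_mem hy.mem.1 hx.mem ⟨ht0.le, ht1⟩,
      mem_halfSpace_neg.2 hz.ge⟩
    rw [add_sub_cancel_left, inner_smul_right] at h
    exact nonpos_of_mul_nonpos_right h ht0
  have hxy : x = y := by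
    have hsub : {x, y} ⊆ C := Set.pair_subset hx.mem hy.mem.1
    exact (hx.mono hsub (Set.mem_insert x _)).unique ⟨by simp, by simp [hyx]⟩
  exact absurd hay (hxy ▸ hax).not_gt

end IsNearestPoint

theorem exists_isNearestPoint [CompleteSpace E] (hne : C.Nonempty) (hC : IsClosed C)
    (hconv : Convex ℝ C) (v : E) : ∃ x, IsNearestPoint C v x := by
  obtain ⟨x, hxC, hx⟩ := exists_norm_eq_iInf_of_complete_convex hne hC.isComplete hconv v
  exact ⟨x, hxC, (norm_eq_iInf_iff_real_inner_le_zero hconv hxC).1 hx⟩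

open Classical in
/-- The point of the convex set `C` nearest to `v`, with the junk value `0` if there is none. -/
def nearestPoint (C : Set E) (v : E) : E :=
  if h : ∃ x, IsNearestPoint C v x then h.choose else 0

theorem IsNearestPoint.nearestPoint_eq (hx : IsNearestPoint C v x) : nearestPoint C v = x := by
  have h : ∃ x, IsNearestPoint C v x := ⟨x, hx⟩
  rw [nearestPoint, dif_pos h]
  exact h.choose_spec.unique hx

theorem isNearestPoint_nearestPoint [CompleteSpace E] (hne : C.Nonempty) (hC : IsClosed C)
    (hconv : Convex ℝ C) (v : E) : IsNearestPoint C v (nearestPoint C v) := by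
  obtain ⟨x, hx⟩ := exists_isNearestPoint hne hC hconv v
  rwa [hx.nearestPoint_eq]

theorem nearestPoint_coe_submodule (W : Submodule ℝ E) [W.HasOrthogonalProjection] (v : E) :
    nearestPoint (W : Set E) v = W.starProjection v := by
  refine IsNearestPoint.nearestPoint_eq ⟨W.starProjection_apply_mem v, fun y hy => ?_⟩
  exact (W.starProjection_inner_eq_zero v _ (W.sub_mem hy (W.starProjection_apply_mem v))).le

end NearestPoint

section Pieces

variable {E : Type*} [NormedAddCommGroup E] [InnerProductSpace ℝ E] {C : Set E} {a x : E}
  {κ M : Type*} [AddCommMonoid M]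

theorem mem_orthogonal_span_image {b : κ → E} {S : Set κ} :
    x ∈ (Submodule.span ℝ (b '' S))ᗮ ↔ ∀ k ∈ S, ⟪b k, x⟫ = 0 := by
  rw [← Submodule.span_singleton_le_iff_mem, ← Submodule.isOrtho_iff_le, Submodule.isOrtho_comm,
    Submodule.isOrtho_span]
  simp

/-- Cutting `C` by a hyperplane, the nearest points to the two halves are, in some order, the
nearest points to `C` and to the cut. -/
theorem apply_nearestPoint_inter_halfSpace_add [CompleteSpace E] (f : E → M) (hC : IsClosed C)
    (hconv : Convex ℝ C) (hne : (C ∩ {y | ⟪a, y⟫ = 0}).Nonempty) (v : E) :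
    f (nearestPoint (C ∩ halfSpace a) v) + f (nearestPoint (C ∩ halfSpace (-a)) v) =
      f (nearestPoint C v) + f (nearestPoint (C ∩ {y | ⟪a, y⟫ = 0}) v) := by
  have hx := isNearestPoint_nearestPoint (hne.mono Set.inter_subset_left) hC hconv v
  wlog hax : nearestPoint C v ∈ halfSpace a generalizing a
  · have h := this (a := -a) (by simpa using hne) (mem_halfSpace_neg.2 (not_le.mp hax).le)
    simpa [add_comm] using h
  have hcut : C ∩ {y | ⟪a, y⟫ = 0} ⊆ C ∩ halfSpace (-a) :=
    Set.inter_subset_inter_right C fun y hy => mem_halfSpace_neg.2 (Eq.ge hy)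
  obtain ⟨y, hy⟩ := exists_isNearestPoint (hne.mono hcut) (hC.inter (isClosed_halfSpace (-a)))
    (hconv.inter (convex_halfSpace (-a))) v
  have hay : ⟪a, y⟫ = 0 := hx.inner_eq_zero_of_inter_halfSpace_neg hconv hax hy
  rw [hy.nearestPoint_eq, (hy.mono hcut ⟨hy.mem.1, hay⟩).nearestPoint_eq,
    (hx.mono Set.inter_subset_left ⟨hx.mem, hax⟩).nearestPoint_eq]

variable [DecidableEq κ]

theorem apply_nearestPoint_inter_halfSpace_inter_orthogonal_add [CompleteSpace E] (f : E → M)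
    (b : κ → E) (hC : IsClosed C) (hconv : Convex ℝ C) (h0 : 0 ∈ C) (v : E) (k : κ)
    (S : Finset κ) :
    f (nearestPoint (C ∩ halfSpace (-b k) ∩ (Submodule.span ℝ (b '' S))ᗮ) v) +
        f (nearestPoint (C ∩ halfSpace (b k) ∩ (Submodule.span ℝ (b '' S))ᗮ) v) =
      f (nearestPoint (C ∩ (Submodule.span ℝ (b '' S))ᗮ) v) +
        f (nearestPoint (C ∩ (Submodule.span ℝ (b '' ↑(insert k S)))ᗮ) v) := by
  have hinsert : C ∩ ((Submodule.span ℝ (b '' ↑(insert k S)))ᗮ : Set E) =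
      C ∩ (Submodule.span ℝ (b '' S))ᗮ ∩ {y | ⟪b k, y⟫ = 0} := by
    ext y
    simp only [Set.mem_inter_iff, SetLike.mem_coe, mem_orthogonal_span_image,
      Finset.coe_insert, Set.forall_mem_insert, Set.mem_ofPred_eq]
    tauto
  rw [hinsert, Set.inter_right_comm, Set.inter_right_comm C (halfSpace (b k)), add_comm]
  exact apply_nearestPoint_inter_halfSpace_add f
    (hC.inter (Submodule.isClosed_orthogonal _)) (hconv.inter (Submodule.convex _))
    ⟨0, ⟨h0, Submodule.zero_mem _⟩, inner_zero_right _⟩ v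

/-- The piece `{y | ±⟪b k, y⟫ ≤ 0 for k ∈ U}` cut out by the hyperplanes orthogonal to the `b k`,
with signs given by the pattern `P`. -/
def signedPiece (U P : Finset κ) (b : κ → E) : Set E :=
  {y | ∀ k ∈ U, y ∈ halfSpace (sgn P k • b k)}

theorem signedPiece_insert_of_notMem {U P : Finset κ} {k : κ} (hk : k ∉ P) (b : κ → E) :
    signedPiece (insert k U) P b = halfSpace (-b k) ∩ signedPiece U P b := by
  ext y
  simp [signedPiece, sgn_of_notMem hk]

theorem signedPiece_insert_insert {U : Finset κ} {k : κ} (hk : k ∉ U) (P : Finset κ)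
    (b : κ → E) :
    signedPiece (insert k U) (insert k P) b = halfSpace (b k) ∩ signedPiece U P b := by
  have hU : ∀ j ∈ U, sgn (insert k P) j = sgn P j :=
    fun j hj => sgn_insert_of_ne P (ne_of_mem_of_not_mem hj hk)
  ext y
  simp +contextual [signedPiece, sgn_of_mem, hU]

/-- As `f` is arbitrary, the nearest points to the pieces into which the hyperplanes orthogonal to
the `b k` cut `C` are, up to order, the nearest points to the sections of `C` by intersections of
those hyperplanes. -/
theorem sum_apply_nearestPoint_inter_signedPiece [CompleteSpace E] (f : E → M) (b : κ → E)
    (v : E) (U : Finset κ) (hC : IsClosed C) (hconv : Convex ℝ C) (h0 : 0 ∈ C) :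
    ∑ P ∈ U.powerset, f (nearestPoint (C ∩ signedPiece U P b) v) =
      ∑ S ∈ U.powerset, f (nearestPoint (C ∩ (Submodule.span ℝ (b '' S))ᗮ) v) := by
  induction U using Finset.induction_on generalizing C with
  | empty => simp [signedPiece]
  | insert k U hk ih =>
    have ih_halfSpace (a : E) := ih (hC.inter (isClosed_halfSpace a))
      (hconv.inter (convex_halfSpace a)) ⟨h0, zero_mem_halfSpace a⟩
    have hneg : ∀ P ∈ U.powerset, C ∩ signedPiece (insert k U) P b =
        C ∩ halfSpace (-b k) ∩ signedPiece U P b := fun P hP => by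
      rw [signedPiece_insert_of_notMem (fun h => hk (Finset.mem_powerset.1 hP h)), Set.inter_assoc]
    have hpos : ∀ P, C ∩ signedPiece (insert k U) (insert k P) b =
        C ∩ halfSpace (b k) ∩ signedPiece U P b := fun P => by
      rw [signedPiece_insert_insert hk, Set.inter_assoc]
    calc ∑ P ∈ (insert k U).powerset, f (nearestPoint (C ∩ signedPiece (insert k U) P b) v)
        = ∑ P ∈ U.powerset, f (nearestPoint (C ∩ halfSpace (-b k) ∩ signedPiece U P b) v) +
          ∑ P ∈ U.powerset, f (nearestPoint (C ∩ halfSpace (b k) ∩ signedPiece U P b) v) := by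
          rw [Finset.sum_powerset_insert hk]
          exact congrArg₂ _ (Finset.sum_congr rfl fun P hP => by rw [hneg P hP])
            (Finset.sum_congr rfl fun P _ => by rw [hpos P])
      _ = ∑ S ∈ (insert k U).powerset,
            f (nearestPoint (C ∩ (Submodule.span ℝ (b '' S))ᗮ) v) := by
          rw [ih_halfSpace, ih_halfSpace, Finset.sum_powerset_insert hk,
            ← Finset.sum_add_distrib, ← Finset.sum_add_distrib]
          exact Finset.sum_congr rfl fun S _ =>
            apply_nearestPoint_inter_halfSpace_inter_orthogonal_add f b hC hconv h0 v k S

end Pieces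

section PolyhedralCone

theorem isClosed_setOf_exists_mem_of_isCompact {X Y : Type*} [TopologicalSpace X]
    [TopologicalSpace Y] {K : Set Y} (hK : IsCompact K) {p : X → Y → Prop}
    (hp : IsClosed {q : X × Y | p q.1 q.2}) : IsClosed {x | ∃ y ∈ K, p x y} := by
  have := isCompact_iff_compactSpace.1 hK
  have himage : {x | ∃ y ∈ K, p x y} =
      Prod.fst '' {q : X × K | p q.1 q.2} := by
    ext x
    simp
  rw [himage]
  exact isClosedMap_fst_of_compactSpace _ (hp.preimage
    (f := Prod.map id Subtype.val) (by fun_prop))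

variable {E : Type*} [NormedAddCommGroup E] [InnerProductSpace ℝ E] {ι κ : Type*}

theorem IsNearestPoint.isGreatest_norm {C : Set E} {v x : E} (hx : IsNearestPoint C v x)
    (hC : ∀ c : ℝ, 0 ≤ c → ∀ y ∈ C, c • y ∈ C) :
    IsGreatest ((fun y => ⟪v, y⟫) '' (C ∩ Metric.closedBall 0 1)) ‖x‖ := by
  have h_orth : ⟪v - x, x⟫ = 0 := by
    have h_zero := hx.inner_le _ (hC 0 le_rfl x hx.mem)
    have h_two := hx.inner_le _ (hC 2 zero_le_two x hx.mem)
    rw [zero_smul, zero_sub, inner_neg_right] at h_zero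
    rw [two_smul, add_sub_cancel_right] at h_two
    linarith
  have h_self : ⟪v, x⟫ = ‖x‖ ^ 2 := by
    rwa [inner_sub_left, sub_eq_zero, real_inner_self_eq_norm_sq] at h_orth
  have h_le : ∀ y ∈ C, ⟪v, y⟫ ≤ ⟪x, y⟫ := by
    intro y hy
    have h := hx.inner_le y hy
    rwa [inner_sub_right, h_orth, sub_zero, inner_sub_left, sub_nonpos] at h
  constructor
  · refine ⟨‖x‖⁻¹ • x, ⟨hC _ (by positivity) x hx.mem, ?_⟩, ?_⟩
    · simpa [norm_smul] using inv_mul_le_one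
    · obtain h | h := eq_or_ne ‖x‖ 0
      · simp [h]
      · simp only [inner_smul_right, h_self]
        field_simp
  · rintro _ ⟨y, ⟨hyC, hy⟩, rfl⟩
    calc ⟪v, y⟫ ≤ ⟪x, y⟫ := h_le y hyC
      _ ≤ ‖x‖ * ‖y‖ := real_inner_le_norm x y
      _ ≤ ‖x‖ := mul_le_of_le_one_right (norm_nonneg x) (by simpa using hy)

theorem IsNearestPoint.map_linearIsometryEquiv {C : Set E} {v x : E} (hx : IsNearestPoint C v x)
    (u : E ≃ₗᵢ[ℝ] E) : IsNearestPoint (u '' C) (u v) (u x) := by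
  refine ⟨Set.mem_image_of_mem u hx.mem, ?_⟩
  rintro _ ⟨y, hy, rfl⟩
  rw [← map_sub, ← map_sub, u.inner_map_map]
  exact hx.inner_le y hy

/-- The cone of solutions of a system of homogeneous linear equations, with rows `g (inl i)`, and
inequalities, with rows `g (inr k)`. -/
def polyhedralCone (g : ι ⊕ κ → E) : Set E :=
  {y | (∀ i, ⟪g (.inl i), y⟫ = 0) ∧ ∀ k, ⟪g (.inr k), y⟫ ≤ 0}

theorem zero_mem_polyhedralCone (g : ι ⊕ κ → E) : 0 ∈ polyhedralCone g := by
  simp [polyhedralCone]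

theorem smul_mem_polyhedralCone (g : ι ⊕ κ → E) {c : ℝ} (hc : 0 ≤ c) {y : E}
    (hy : y ∈ polyhedralCone g) : c • y ∈ polyhedralCone g :=
  ⟨fun i => by simp [inner_smul_right, hy.1 i], fun k => by
    simpa [inner_smul_right] using mul_nonpos_of_nonneg_of_nonpos hc (hy.2 k)⟩

theorem polyhedralCone_eq_iInter (g : ι ⊕ κ → E) : polyhedralCone g =
    ((Submodule.span ℝ (g ∘ Sum.inl '' Set.univ))ᗮ : Set E) ∩ ⋂ k, halfSpace (g (.inr k)) := by
  ext y
  simp only [Set.mem_inter_iff, SetLike.mem_coe, mem_orthogonal_span_image, Set.mem_iInter]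
  simp [polyhedralCone, mem_halfSpace]

theorem isClosed_polyhedralCone (g : ι ⊕ κ → E) : IsClosed (polyhedralCone g) := by
  rw [polyhedralCone_eq_iInter]
  exact (Submodule.isClosed_orthogonal _).inter (isClosed_iInter fun k => isClosed_halfSpace _)

theorem convex_polyhedralCone (g : ι ⊕ κ → E) : Convex ℝ (polyhedralCone g) := by
  rw [polyhedralCone_eq_iInter]
  exact (Submodule.convex _).inter (convex_iInter fun k => convex_halfSpace _)

theorem polyhedralCone_map (g : ι ⊕ κ → E) (u : E ≃ₗᵢ[ℝ] E) :
    polyhedralCone (fun r => u (g r)) = u '' polyhedralCone g := by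
  ext y
  obtain ⟨x, rfl⟩ := u.surjective y
  simp [polyhedralCone, u.injective.mem_set_image]

/-- The system of constraints with the inequalities outside `P` reversed. -/
def flipRows [DecidableEq κ] (P : Finset κ) (g : ι ⊕ κ → E) : ι ⊕ κ → E :=
  Sum.elim (g ∘ Sum.inl) fun k => sgn P k • g (.inr k)

theorem polyhedralCone_flipRows [Fintype κ] [DecidableEq κ] (P : Finset κ) (g : ι ⊕ κ → E) :
    polyhedralCone (flipRows P g) = ((Submodule.span ℝ (g ∘ Sum.inl '' Set.univ))ᗮ : Set E) ∩
      signedPiece Finset.univ P (g ∘ Sum.inr) := by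
  ext y
  simp only [Set.mem_inter_iff, SetLike.mem_coe, mem_orthogonal_span_image]
  simp [polyhedralCone, flipRows, signedPiece, mem_halfSpace]

variable (ι) in
/-- The indices of all equality constraints and of the inequality constraints in `S`. -/
def activeRows [Fintype ι] (S : Finset κ) : Finset (ι ⊕ κ) := Finset.univ.disjSum S

theorem card_activeRows [Fintype ι] (S : Finset κ) :
    (activeRows ι S).card = Fintype.card ι + S.card := by
  simp [activeRows]

theorem orthogonal_span_inl_inter_orthogonal_span_inr [Fintype ι] (g : ι ⊕ κ → E)
    (S : Finset κ) :
    ((Submodule.span ℝ (g ∘ Sum.inl '' Set.univ))ᗮ : Set E) ∩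
      (Submodule.span ℝ (g ∘ Sum.inr '' S))ᗮ =
        (Submodule.span ℝ (g '' activeRows ι S))ᗮ := by
  ext y
  simp only [Set.mem_inter_iff, SetLike.mem_coe, mem_orthogonal_span_image]
  simp [activeRows]

section Complete

variable [CompleteSpace E]

theorem isNearestPoint_nearestPoint_polyhedralCone (g : ι ⊕ κ → E) (v : E) :
    IsNearestPoint (polyhedralCone g) v (nearestPoint (polyhedralCone g) v) :=
  isNearestPoint_nearestPoint ⟨0, zero_mem_polyhedralCone g⟩ (isClosed_polyhedralCone g)
    (convex_polyhedralCone g) v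

theorem isGreatest_norm_nearestPoint_polyhedralCone (g : ι ⊕ κ → E) (v : E) :
    IsGreatest ((fun y => ⟪v, y⟫) '' (polyhedralCone g ∩ Metric.closedBall 0 1))
      ‖nearestPoint (polyhedralCone g) v‖ :=
  (isNearestPoint_nearestPoint_polyhedralCone g v).isGreatest_norm
    fun _ hc _ hy => smul_mem_polyhedralCone g hc hy

theorem norm_nearestPoint_polyhedralCone_map (g : ι ⊕ κ → E) (v : E) (u : E ≃ₗᵢ[ℝ] E) :
    ‖nearestPoint (polyhedralCone fun r => u (g r)) (u v)‖ =
      ‖nearestPoint (polyhedralCone g) v‖ := by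
  rw [polyhedralCone_map, ((isNearestPoint_nearestPoint_polyhedralCone g
    v).map_linearIsometryEquiv u).nearestPoint_eq, u.norm_map]

theorem le_norm_nearestPoint_polyhedralCone_iff {g : ι ⊕ κ → E} {v : E} {c : ℝ} :
    c ≤ ‖nearestPoint (polyhedralCone g) v‖ ↔
      ∃ y ∈ Metric.closedBall 0 1, y ∈ polyhedralCone g ∧ c ≤ ⟪v, y⟫ := by
  have h := isGreatest_norm_nearestPoint_polyhedralCone g v
  constructor
  · obtain ⟨y, ⟨hyC, hy⟩, hv⟩ := h.1
    exact fun hc => ⟨y, hy, hyC, hc.trans_eq hv.symm⟩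
  · rintro ⟨y, hy, hyC, hc⟩
    exact hc.trans (h.2 ⟨y, ⟨hyC, hy⟩, rfl⟩)

end Complete

theorem measurable_norm_nearestPoint_polyhedralCone [FiniteDimensional ℝ E] [MeasurableSpace E]
    [BorelSpace E] [Finite ι] [Finite κ] (v : E) :
    Measurable fun g : ι ⊕ κ → E => ‖nearestPoint (polyhedralCone g) v‖ := by
  refine measurable_of_Ici fun c => IsClosed.measurableSet ?_
  simp only [Set.preimage, Set.mem_Ici, le_norm_nearestPoint_polyhedralCone_iff]
  refine isClosed_setOf_exists_mem_of_isCompact (isCompact_closedBall 0 1) ?_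
  simp only [polyhedralCone, Set.mem_ofPred_eq]
  simp only [Set.ofPred_and, Set.ofPred_forall]
  refine IsClosed.inter (.inter ?_ ?_) ?_
  · exact isClosed_iInter fun i => isClosed_eq (by fun_prop) continuous_const
  · exact isClosed_iInter fun k => isClosed_le (by fun_prop) continuous_const
  · exact isClosed_le continuous_const (by fun_prop)

theorem sum_apply_nearestPoint_polyhedralCone_flipRows [FiniteDimensional ℝ E] [Fintype ι]
    [Fintype κ] [DecidableEq κ] {M : Type*} [AddCommMonoid M] (f : E → M) (g : ι ⊕ κ → E)
    (v : E) :
    ∑ P : Finset κ, f (nearestPoint (polyhedralCone (flipRows P g)) v) =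
      ∑ S : Finset κ,
        f ((Submodule.span ℝ (g '' activeRows ι S))ᗮ.starProjection v) := by
  simp only [polyhedralCone_flipRows, ← nearestPoint_coe_submodule,
    ← orthogonal_span_inl_inter_orthogonal_span_inr]
  simpa only [Finset.powerset_univ] using sum_apply_nearestPoint_inter_signedPiece f
    (g ∘ Sum.inr) v Finset.univ (Submodule.isClosed_orthogonal _) (Submodule.convex _)
    (Submodule.zero_mem _)

end PolyhedralCone

section Projection

variable {E J : Type*} [NormedAddCommGroup E] [InnerProductSpace ℝ E]

theorem norm_starProjection_sq (W : Submodule ℝ E) [W.HasOrthogonalProjection] (x : E) :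
    ‖W.starProjection x‖ ^ 2 = ⟪x, W.starProjection x⟫ := by
  rw [← Submodule.inner_starProjection_left_eq_right]
  simpa using (W.re_inner_starProjection_eq_normSq x).symm

variable [FiniteDimensional ℝ E] [Fintype J]

theorem sum_inner_starProjection_self (b : OrthonormalBasis J ℝ E)
    (W : Submodule ℝ E) :
    ∑ i, ⟪b i, W.starProjection (b i)⟫ = Module.finrank ℝ W := by
  have hproj : LinearMap.IsProj W (W.starProjection : E →ₗ[ℝ] E) :=
    ⟨W.starProjection_apply_mem, fun _ hx => Submodule.starProjection_eq_self_iff.2 hx⟩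
  rw [← hproj.trace, LinearMap.trace_eq_sum_inner _ b]
  rfl

theorem sum_sum_inner_starProjection_sq (b : OrthonormalBasis J ℝ E)
    (W : Submodule ℝ E) :
    ∑ i, ∑ j, ⟪b i, W.starProjection (b j)⟫ ^ 2 = Module.finrank ℝ W := by
  rw [← sum_inner_starProjection_self b, Finset.sum_comm]
  refine Finset.sum_congr rfl fun j _ => ?_
  have h := b.sum_sq_norm_inner_right (W.starProjection (b j))
  simp only [Real.norm_eq_abs, sq_abs] at h
  rw [h, norm_starProjection_sq]

end Projection

section SignVector

variable {J : Type*} [Fintype J] [DecidableEq J]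

/-- The vertex of the cube `[-1, 1] ^ J` with the given sign pattern. In particular `signVec ∅` is
minus the all-ones vector, the direction in which the coordinate sum decreases fastest. -/
def signVec (P : Finset J) : EuclideanSpace ℝ J := WithLp.toLp 2 (sgn P)

theorem signVec_eq_sum (P : Finset J) :
    signVec P = ∑ j, sgn P j • EuclideanSpace.basisFun J ℝ j := by
  rw [← (EuclideanSpace.basisFun J ℝ).sum_repr (signVec P)]
  simp [signVec]

theorem norm_starProjection_signVec_sq_sub_finrank (W : Submodule ℝ (EuclideanSpace ℝ J))
    (P : Finset J) :
    ‖W.starProjection (signVec P)‖ ^ 2 - Module.finrank ℝ W =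
      centeredQuadForm (fun i j => ⟪EuclideanSpace.basisFun J ℝ i,
        W.starProjection (EuclideanSpace.basisFun J ℝ j)⟫) Finset.univ P := by
  rw [centeredQuadForm, sum_inner_starProjection_self, norm_starProjection_sq, signVec_eq_sum,
    map_sum, sum_inner]
  congr 1
  refine Finset.sum_congr rfl fun i _ => ?_
  rw [inner_sum]
  refine Finset.sum_congr rfl fun j _ => ?_
  rw [map_smul, real_inner_smul_left, real_inner_smul_right]
  ring

theorem sum_sq_norm_starProjection_signVec_sub_finrank_le
    (W : Submodule ℝ (EuclideanSpace ℝ J)) :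
    ∑ P : Finset J, (‖W.starProjection (signVec P)‖ ^ 2 - Module.finrank ℝ W) ^ 2 ≤
      2 ^ Fintype.card J * (2 * Fintype.card J) := by
  have hle : (Module.finrank ℝ W : ℝ) ≤ Fintype.card J := by
    exact_mod_cast W.finrank_le.trans_eq finrank_euclideanSpace
  simp only [norm_starProjection_signVec_sq_sub_finrank]
  rw [← Finset.powerset_univ]
  refine (sum_powerset_centeredQuadForm_sq_le (fun i j => ?_) Finset.univ).trans ?_
  · rw [← Submodule.inner_starProjection_left_eq_right, real_inner_comm]
  · rw [sum_sum_inner_starProjection_sq, Finset.card_univ]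
    gcongr

end SignVector

section GeneralPosition

theorem measure_pi_eq_zero_of_forall_slice {I : Type*} [Fintype I] [DecidableEq I]
    {X : I → Type*} [∀ i, MeasurableSpace (X i)] (μ : ∀ i, Measure (X i))
    [∀ i, SigmaFinite (μ i)] (i : I) {B : Set (∀ i, X i)} (hB : MeasurableSet B)
    (h : ∀ x, μ i {t | Function.update x i t ∈ B} = 0) : Measure.pi μ B = 0 := by
  have hslice : (fun x => ∫⁻ t, B.indicator 1 (Function.update x i t) ∂μ i) = 0 := by
    funext x
    rw [Pi.zero_apply, ← h x]
    exact lintegral_indicator_one (measurable_update x hB)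
  rcases isEmpty_or_nonempty (∀ i, X i) with hempty | ⟨⟨x⟩⟩
  · rw [Set.eq_empty_of_isEmpty B, measure_empty]
  · rw [← lintegral_indicator_one hB, lintegral_eq_lmarginal_univ x,
      lmarginal_erase' _ (measurable_one.indicator hB) (Finset.mem_univ i), hslice]
    simp [lmarginal]

variable {E : Type*} [NormedAddCommGroup E] [InnerProductSpace ℝ E] {R : Type*}

/-- The vectors `g r` are in general position: as many of them as the dimension allows are
linearly independent, however they are chosen. -/
def InGeneralPosition (g : R → E) : Prop :=
  ∀ T : Finset R, T.card ≤ Module.finrank ℝ E → LinearIndepOn ℝ g T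

theorem finrank_span_image_le_card (g : R → E) (T : Finset R) :
    Module.finrank ℝ (Submodule.span ℝ (g '' T)) ≤ T.card := by
  rw [Set.image_eq_range]
  simpa [Set.finrank] using finrank_range_le_card (R := ℝ) fun r : (T : Set R) => g r

theorem InGeneralPosition.finrank_orthogonal_span [FiniteDimensional ℝ E] {g : R → E}
    (hg : InGeneralPosition g) (T : Finset R) :
    Module.finrank ℝ (Submodule.span ℝ (g '' T))ᗮ = Module.finrank ℝ E - T.card := by
  obtain ⟨T', hT'T, hT'⟩ : ∃ T' ⊆ T, T'.card = min T.card (Module.finrank ℝ E) :=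
    Finset.exists_subset_card_eq (min_le_left _ _)
  have hT'_span : Module.finrank ℝ (Submodule.span ℝ (g '' T')) = T'.card := by
    have h := finrank_span_eq_card (hg T' (hT' ▸ min_le_right _ _)).linearIndependent
    rw [Set.image_eq_range]
    simpa using h
  have hadd := (Submodule.span ℝ (g '' T)).finrank_add_finrank_orthogonal
  have hle := finrank_span_image_le_card g T
  have hge : T'.card ≤ Module.finrank ℝ (Submodule.span ℝ (g '' T)) := hT'_span.symm.trans_le
    (Submodule.finrank_mono (Submodule.span_mono (Set.image_mono hT'T)))
  omega

variable [MeasurableSpace E] [BorelSpace E] [FiniteDimensional ℝ E]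

theorem measurableSet_setOf_linearIndepOn [Finite R] (T : Set R) :
    MeasurableSet {g : R → E | LinearIndepOn ℝ g T} := by
  have h : Measurable fun (g : R → E) (r : T) => g r := by fun_prop
  exact h isOpen_setOfPred_linearIndependent.measurableSet

theorem ae_linearIndepOn_insert [Fintype R] {μ : Measure E} [SigmaFinite μ]
    (hμ : ∀ W : Submodule ℝ E, W ≠ ⊤ → μ W = 0) {T : Finset R} {r : R} (hr : r ∉ T)
    (hT : T.card < Module.finrank ℝ E) :
    ∀ᵐ g ∂Measure.pi fun _ : R => μ,
      LinearIndepOn ℝ g T → LinearIndepOn ℝ g (insert r T : Set R) := by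
  classical
  have hmeas : MeasurableSet {g : R → E | ¬(LinearIndepOn ℝ g T →
      LinearIndepOn ℝ g (insert r T : Set R))} :=
    ((measurableSet_setOf_linearIndepOn _).imp (measurableSet_setOf_linearIndepOn _)).compl
  refine measure_pi_eq_zero_of_forall_slice _ r hmeas fun g => ?_
  have hspan : Submodule.span ℝ (g '' T) ≠ ⊤ := fun htop => by
    have hle := finrank_span_image_le_card g T
    rw [htop, finrank_top] at hle
    omega
  refine measure_mono_null (fun t ht => ?_) (hμ _ hspan)
  by_contra htspan
  have hupd : Function.update g r t '' T = g '' T :=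
    Set.image_congr fun k hk => Function.update_of_ne (ne_of_mem_of_not_mem hk hr) _ _
  refine ht fun hT' => hT'.insert ?_
  rwa [hupd, Function.update_self]

theorem ae_inGeneralPosition [Fintype R] {μ : Measure E} [SigmaFinite μ]
    (hμ : ∀ W : Submodule ℝ E, W ≠ ⊤ → μ W = 0) :
    ∀ᵐ g ∂Measure.pi fun _ : R => μ, InGeneralPosition g := by
  classical
  refine ae_all_iff.2 fun T => ?_
  induction T using Finset.induction_on with
  | empty => simp
  | insert r T hr ih =>
    rw [eventually_imp_distrib_left]
    intro hcard
    rw [Finset.card_insert_of_notMem hr] at hcard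
    filter_upwards [ih, ae_linearIndepOn_insert hμ hr hcard] with g hgT hg
    simpa using hg (hgT (by omega))

theorem stdGaussian_submodule_eq_zero {W : Submodule ℝ E} (hW : W ≠ ⊤) :
    stdGaussian E W = 0 := by
  obtain ⟨w, hwW, hw⟩ := Submodule.exists_mem_ne_zero_of_ne_bot
    (mt Submodule.orthogonal_eq_bot_iff.1 hW)
  have hlaw : (stdGaussian E).map (innerSL ℝ w) = gaussianReal 0 (‖w‖₊ ^ 2) := by
    rw [IsGaussian.map_eq_gaussianReal, integral_strongDual_stdGaussian,
      variance_dual_stdGaussian, innerSL_apply_norm, ← coe_nnnorm, ← NNReal.coe_pow,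
      Real.toNNReal_coe]
  have : NullSingletonClass (gaussianReal 0 (‖w‖₊ ^ 2)) :=
    nullSingletonClass_gaussianReal (by simpa)
  have hker : stdGaussian E (innerSL ℝ w ⁻¹' {0}) = 0 := by
    rw [← Measure.map_apply (by fun_prop) (measurableSet_singleton 0), hlaw, measure_singleton]
  exact measure_mono_null (fun x hx => Submodule.inner_left_of_mem_orthogonal hx hwW) hker

end GeneralPosition

section Symmetrization

variable {E : Type*} [NormedAddCommGroup E] [InnerProductSpace ℝ E] [FiniteDimensional ℝ E]
  [MeasurableSpace E] [BorelSpace E] {ι κ J : Type*}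

theorem measurePreserving_stdGaussian (u : E ≃ₗᵢ[ℝ] E) :
    MeasurePreserving u (stdGaussian E) (stdGaussian E) :=
  ⟨u.continuous.measurable, stdGaussian_map u⟩

theorem measurePreserving_flipRows [Fintype ι] [Fintype κ] [DecidableEq κ] (P : Finset κ) :
    MeasurePreserving (flipRows P) (Measure.pi fun _ : ι ⊕ κ => stdGaussian E)
      (Measure.pi fun _ => stdGaussian E) := by
  let u : ι ⊕ κ → E ≃ₗᵢ[ℝ] E :=
    Sum.elim (fun _ => .refl ℝ E) fun k => if k ∈ P then .refl ℝ E else .neg ℝ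
  convert measurePreserving_pi (fun _ => stdGaussian E) (fun _ => stdGaussian E)
    fun r => measurePreserving_stdGaussian (u r) with g r
  rcases r with i | k
  · rfl
  · by_cases hk : k ∈ P <;> simp [flipRows, u, sgn, hk]

variable [Fintype J] [DecidableEq J]

/-- The isometry that changes the sign of the coordinates in `P`. -/
def flipCoords (P : Finset J) : EuclideanSpace ℝ J ≃ₗᵢ[ℝ] EuclideanSpace ℝ J :=
  .piLpCongrRight 2 fun j => if j ∈ P then .neg ℝ else .refl ℝ ℝ

theorem flipCoords_signVec (P : Finset J) : flipCoords P (signVec P) = signVec ∅ := by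
  ext j
  by_cases hj : j ∈ P <;> simp [flipCoords, signVec, sgn, hj]

variable [Fintype ι] [Fintype κ]

theorem lintegral_norm_nearestPoint_flipRows [DecidableEq κ] {F : ℝ → ENNReal}
    (hF : Measurable F) (P : Finset κ) (Q : Finset J) :
    ∫⁻ g, F ‖nearestPoint (polyhedralCone (flipRows P g)) (signVec Q)‖
        ∂Measure.pi (fun _ : ι ⊕ κ => stdGaussian (EuclideanSpace ℝ J)) =
      ∫⁻ g, F ‖nearestPoint (polyhedralCone g) (signVec ∅)‖
        ∂Measure.pi (fun _ : ι ⊕ κ => stdGaussian (EuclideanSpace ℝ J)) := by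
  have hpres := (measurePreserving_pi (fun _ => stdGaussian _) (fun _ => stdGaussian _) fun _ =>
    measurePreserving_stdGaussian (flipCoords Q)).comp (measurePreserving_flipRows (ι := ι) P)
  refine .trans ?_ (hpres.lintegral_comp
    (hF.comp (measurable_norm_nearestPoint_polyhedralCone (signVec (∅ : Finset J)))))
  simp only [Function.comp_apply, ← flipCoords_signVec Q, norm_nearestPoint_polyhedralCone_map]

theorem two_pow_mul_lintegral_norm_nearestPoint {F : ℝ → ENNReal} (hF : Measurable F) :
    2 ^ (Fintype.card κ + Fintype.card J) *
        ∫⁻ g, F ‖nearestPoint (polyhedralCone g) (signVec ∅)‖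
          ∂Measure.pi (fun _ : ι ⊕ κ => stdGaussian (EuclideanSpace ℝ J)) =
      ∫⁻ g, ∑ Q : Finset J, ∑ S : Finset κ,
          F ‖(Submodule.span ℝ (g '' activeRows ι S))ᗮ.starProjection (signVec Q)‖
        ∂Measure.pi (fun _ : ι ⊕ κ => stdGaussian (EuclideanSpace ℝ J)) := by
  classical
  have hmeas (Q : Finset J) (P : Finset κ) : Measurable fun g : ι ⊕ κ → EuclideanSpace ℝ J =>
      F ‖nearestPoint (polyhedralCone (flipRows P g)) (signVec Q)‖ :=
    hF.comp ((measurable_norm_nearestPoint_polyhedralCone _).comp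
      (measurePreserving_flipRows P).measurable)
  simp only [← sum_apply_nearestPoint_polyhedralCone_flipRows (fun x => F ‖x‖)]
  rw [lintegral_finsetSum _ fun Q _ => Finset.measurable_sum _ fun P _ => hmeas Q P]
  simp only [lintegral_finsetSum _ fun P _ => hmeas _ P,
    lintegral_norm_nearestPoint_flipRows hF, Finset.sum_const, Finset.card_univ,
    Fintype.card_finset, nsmul_eq_mul]
  push_cast
  ring

theorem measure_norm_nearestPoint_mem_le {T : Set ℝ} (hT : MeasurableSet T) {C : ℝ}
    (hC : ∀ g : ι ⊕ κ → EuclideanSpace ℝ J, InGeneralPosition g →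
      ∑ Q : Finset J, ∑ S : Finset κ, T.indicator (1 : ℝ → ℝ)
        ‖(Submodule.span ℝ (g '' activeRows ι S))ᗮ.starProjection (signVec Q)‖ ≤
      2 ^ (Fintype.card κ + Fintype.card J) * C) :
    Measure.pi (fun _ : ι ⊕ κ => stdGaussian (EuclideanSpace ℝ J))
      {g | ‖nearestPoint (polyhedralCone g) (signVec ∅)‖ ∈ T} ≤ ENNReal.ofReal C := by
  have hpow : (2 : ENNReal) ^ (Fintype.card κ + Fintype.card J) =
      ENNReal.ofReal (2 ^ (Fintype.card κ + Fintype.card J)) := by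
    rw [ENNReal.ofReal_pow two_pos.le, ENNReal.ofReal_ofNat]
  have hT_nonneg (t : ℝ) : 0 ≤ T.indicator (1 : ℝ → ℝ) t :=
    Set.indicator_nonneg (fun _ _ => zero_le_one) t
  have hT_ofReal (t : ℝ) :
      T.indicator (1 : ℝ → ENNReal) t = ENNReal.ofReal (T.indicator (1 : ℝ → ℝ) t) := by
    by_cases ht : t ∈ T <;> simp [ht]
  refine (ENNReal.mul_le_mul_iff_right (a := 2 ^ (Fintype.card κ + Fintype.card J))
    (by simp) (by simp)).1 ?_
  have hmeas : MeasurableSet {g : ι ⊕ κ → EuclideanSpace ℝ J |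
      ‖nearestPoint (polyhedralCone g) (signVec ∅)‖ ∈ T} :=
    measurable_norm_nearestPoint_polyhedralCone _ hT
  rw [← lintegral_indicator_one hmeas]
  refine (two_pow_mul_lintegral_norm_nearestPoint (measurable_one.indicator hT)).trans_le ?_
  rw [hpow, ← ENNReal.ofReal_mul (by positivity)]
  refine lintegral_le_const ?_
  filter_upwards [ae_inGeneralPosition fun W => stdGaussian_submodule_eq_zero] with g hg
  simp only [hT_ofReal, ← ENNReal.ofReal_sum_of_nonneg fun _ _ => hT_nonneg _,
    ← ENNReal.ofReal_sum_of_nonneg fun _ _ => Finset.sum_nonneg fun _ _ => hT_nonneg _]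
  exact ENNReal.ofReal_le_ofReal (hC g hg)

end Symmetrization

section Concentration

theorem indicator_one_le_sq_div_sq {X : Type*} {T : Set X} {t : X} {b δ : ℝ} (hδ : 0 < δ)
    (h : t ∈ T → δ ≤ |b|) : T.indicator (1 : X → ℝ) t ≤ b ^ 2 / δ ^ 2 := by
  by_cases ht : t ∈ T
  · rw [Set.indicator_of_mem ht, Pi.one_apply, one_le_div (by positivity), ← sq_abs b]
    gcongr
    exact h ht
  · rw [Set.indicator_of_notMem ht]
    positivity

theorem abs_natCast_sub_sub_max_le (n k : ℕ) (c : ℝ) :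
    |((n - k : ℕ) : ℝ) - max 0 (n - c)| ≤ |k - c| := by
  have hcast : ((n - k : ℕ) : ℝ) = max 0 ((n : ℝ) - k) := by
    rcases le_total n k with h | h
    · rw [Nat.sub_eq_zero_of_le h, Nat.cast_zero, max_eq_left (sub_nonpos.2 (Nat.cast_le.2 h))]
    · rw [Nat.cast_sub h, max_eq_right (sub_nonneg.2 (Nat.cast_le.2 h))]
  calc |((n - k : ℕ) : ℝ) - max 0 (n - c)|
      ≤ |((n : ℝ) - k) - (n - c)| := by
        rw [hcast, max_comm 0, max_comm 0]
        exact abs_max_sub_max_le_abs _ _ _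
    _ = |k - c| := by rw [sub_sub_sub_cancel_left, abs_sub_comm]

theorem sum_card_sub_half_sq (κ : Type*) [Fintype κ] :
    ∑ S : Finset κ, ((S.card : ℝ) - Fintype.card κ / 2) ^ 2 =
      (2 : ℝ) ^ Fintype.card κ * (Fintype.card κ / 4) := by
  simpa using sum_powerset_card_sub_half_sq (Finset.univ : Finset κ)

variable {ι κ J : Type*} [Fintype ι] [Fintype J] {g : ι ⊕ κ → EuclideanSpace ℝ J}

theorem InGeneralPosition.finrank_orthogonal_span_activeRows (hg : InGeneralPosition g)
    (S : Finset κ) : Module.finrank ℝ (Submodule.span ℝ (g '' activeRows ι S))ᗮ =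
      Fintype.card J - (Fintype.card ι + S.card) := by
  rw [hg.finrank_orthogonal_span, card_activeRows, finrank_euclideanSpace]

theorem InGeneralPosition.starProjection_orthogonal_span_activeRows_eq_zero
    (hg : InGeneralPosition g) {S : Finset κ} (hS : Fintype.card J ≤ Fintype.card ι + S.card)
    (v : EuclideanSpace ℝ J) :
    (Submodule.span ℝ (g '' activeRows ι S))ᗮ.starProjection v = 0 := by
  have hbot : (Submodule.span ℝ (g '' activeRows ι S))ᗮ = ⊥ := by
    rw [← Submodule.finrank_eq_zero, hg.finrank_orthogonal_span_activeRows,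
      Nat.sub_eq_zero_of_le hS]
  simp [hbot]

theorem InGeneralPosition.sq_finrank_orthogonal_span_activeRows_sub_max_le
    (hg : InGeneralPosition g) (S : Finset κ) (c : ℝ) :
    (Module.finrank ℝ (Submodule.span ℝ (g '' activeRows ι S))ᗮ -
      max 0 (Fintype.card J - (Fintype.card ι + c))) ^ 2 ≤ (S.card - c) ^ 2 := by
  have h := abs_natCast_sub_sub_max_le (Fintype.card J) (Fintype.card ι + S.card)
    (Fintype.card ι + c)
  rw [hg.finrank_orthogonal_span_activeRows, sq_le_sq]
  rwa [Nat.cast_add, add_sub_add_left_eq_sub] at h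

variable [Fintype κ] [DecidableEq J]

theorem InGeneralPosition.sum_sq_norm_starProjection_sub_max_le (hg : InGeneralPosition g) :
    ∑ Q : Finset J, ∑ S : Finset κ,
      (‖(Submodule.span ℝ (g '' activeRows ι S))ᗮ.starProjection (signVec Q)‖ ^ 2 -
        max 0 (Fintype.card J - (Fintype.card ι + Fintype.card κ / 2 : ℝ))) ^ 2 ≤
      2 ^ (Fintype.card κ + Fintype.card J) * (4 * Fintype.card J + Fintype.card κ / 2) := by
  set W := fun S : Finset κ => (Submodule.span ℝ (g '' activeRows ι S))ᗮ
  set M := max 0 (Fintype.card J - (Fintype.card ι + Fintype.card κ / 2 : ℝ))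
  have hsq (S : Finset κ) (Q : Finset J) : (‖(W S).starProjection (signVec Q)‖ ^ 2 - M) ^ 2 ≤
      2 * ((‖(W S).starProjection (signVec Q)‖ ^ 2 - Module.finrank ℝ (W S)) ^ 2 +
        ((S.card : ℝ) - Fintype.card κ / 2) ^ 2) := by
    rw [← sub_add_sub_cancel _ (Module.finrank ℝ (W S) : ℝ) M]
    refine add_sq_le.trans ?_
    gcongr 2 * (_ + ?_)
    exact hg.sq_finrank_orthogonal_span_activeRows_sub_max_le S _
  rw [Finset.sum_comm]
  calc ∑ S, ∑ Q, (‖(W S).starProjection (signVec Q)‖ ^ 2 - M) ^ 2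
      ≤ ∑ S : Finset κ, 2 * (2 ^ Fintype.card J * (2 * Fintype.card J) +
          2 ^ Fintype.card J * ((S.card : ℝ) - Fintype.card κ / 2) ^ 2) := by
        refine Finset.sum_le_sum fun S _ => (Finset.sum_le_sum fun Q _ => hsq S Q).trans ?_
        rw [← Finset.mul_sum, Finset.sum_add_distrib, Finset.sum_const, Finset.card_univ,
          Fintype.card_finset, nsmul_eq_mul, Nat.cast_pow, Nat.cast_two]
        gcongr
        exact sum_sq_norm_starProjection_signVec_sub_finrank_le (W S)
    _ = _ := by
        rw [← Finset.mul_sum, Finset.sum_add_distrib, Finset.sum_const, ← Finset.mul_sum,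
          sum_card_sub_half_sq, Finset.card_univ, Fintype.card_finset, nsmul_eq_mul]
        push_cast
        ring

variable (ι κ J)

theorem measure_le_abs_sq_norm_nearestPoint_sub_max_le {δ : ℝ} (hδ : 0 < δ) :
    Measure.pi (fun _ : ι ⊕ κ => stdGaussian (EuclideanSpace ℝ J))
      {g | δ ≤ |‖nearestPoint (polyhedralCone g) (signVec ∅)‖ ^ 2 -
        max 0 (Fintype.card J - (Fintype.card ι + Fintype.card κ / 2 : ℝ))|} ≤
      ENNReal.ofReal ((4 * Fintype.card J + Fintype.card κ / 2) / δ ^ 2) := by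
  set M := max 0 (Fintype.card J - (Fintype.card ι + Fintype.card κ / 2 : ℝ))
  refine measure_norm_nearestPoint_mem_le (T := {t | δ ≤ |t ^ 2 - M|})
    (measurableSet_le measurable_const (by fun_prop)) fun g hg => ?_
  calc ∑ Q, ∑ S, _
      ≤ ∑ Q, ∑ S, _ := Finset.sum_le_sum fun Q _ => Finset.sum_le_sum fun S _ =>
        indicator_one_le_sq_div_sq hδ id
    _ ≤ _ := by
        simp only [← Finset.sum_div, ← mul_div_assoc]
        gcongr
        exact hg.sum_sq_norm_starProjection_sub_max_le

theorem measure_nearestPoint_ne_zero_le {δ : ℝ} (hδ : 0 < δ)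
    (h : (Fintype.card J : ℝ) + δ ≤ Fintype.card ι + Fintype.card κ / 2) :
    Measure.pi (fun _ : ι ⊕ κ => stdGaussian (EuclideanSpace ℝ J))
      {g | ‖nearestPoint (polyhedralCone g) (signVec ∅)‖ ≠ 0} ≤
      ENNReal.ofReal ((Fintype.card κ / 4) / δ ^ 2) := by
  refine measure_norm_nearestPoint_mem_le (measurableSet_singleton (0 : ℝ)).compl fun g hg => ?_
  have hind (Q : Finset J) (S : Finset κ) : ({0}ᶜ : Set ℝ).indicator (1 : ℝ → ℝ)
      ‖(Submodule.span ℝ (g '' activeRows ι S))ᗮ.starProjection (signVec Q)‖ ≤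
        ((S.card : ℝ) - Fintype.card κ / 2) ^ 2 / δ ^ 2 := by
    refine indicator_one_le_sq_div_sq hδ fun hne => ?_
    have hlt : Fintype.card ι + S.card < Fintype.card J := by
      by_contra! hle
      exact hne (by simp [hg.starProjection_orthogonal_span_activeRows_eq_zero hle])
    have hlt' : (Fintype.card ι + S.card : ℝ) < Fintype.card J := by exact_mod_cast hlt
    exact le_abs.2 (.inr (by linarith))
  refine (Finset.sum_le_sum fun Q _ => Finset.sum_le_sum fun S _ => hind Q S).trans_eq ?_
  rw [← Finset.sum_div, sum_card_sub_half_sq, Finset.sum_const, Finset.card_univ,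
    Fintype.card_finset, nsmul_eq_mul]
  push_cast
  ring

end Concentration

section RowLaw

theorem measurePreserving_curry {R J X : Type*} [Fintype R] [Fintype J] [MeasurableSpace X]
    (ν : Measure X) [IsProbabilityMeasure ν] :
    MeasurePreserving (MeasurableEquiv.curry R J X) (Measure.pi fun _ => ν)
      (Measure.pi fun _ => Measure.pi fun _ => ν) :=
  ⟨MeasurableEquiv.measurable _, by
    simpa only [Measure.infinitePi_eq_pi] using
      Measure.infinitePi_map_curry fun (_ : R) (_ : J) => ν⟩

theorem hasLaw_rows_stdGaussian {Ω R J : Type*} [MeasurableSpace Ω] {μ : Measure Ω}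
    [Fintype R] [Fintype J] {X : R × J → Ω → ℝ}
    (hX : ∀ p, HasLaw (X p) (gaussianReal 0 1) μ) (hindep : iIndepFun X μ) :
    HasLaw (fun ω r => WithLp.toLp 2 fun j => X (r, j) ω)
      (Measure.pi fun _ : R => stdGaussian (EuclideanSpace ℝ J)) μ := by
  have htoLp : MeasurePreserving (WithLp.toLp 2) (Measure.pi fun _ : J => gaussianReal 0 1)
      (stdGaussian (EuclideanSpace ℝ J)) := ⟨by fun_prop, map_pi_eq_stdGaussian⟩
  have hrows := (measurePreserving_pi (fun _ : R => _) (fun _ => _) fun _ => htoLp).comp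
    (measurePreserving_curry (R := R) (gaussianReal 0 1))
  exact hrows.comp_hasLaw (hindep.hasLaw_pi hX)

end RowLaw

section OptimalValue

variable {m₁ m₂ n : ℕ}

/-- The rows of `A` followed by the rows of `B`, as vectors of Euclidean space. -/
def constraintVec (A : Matrix (Fin m₁) (Fin n) ℝ) (B : Matrix (Fin m₂) (Fin n) ℝ) :
    Fin m₁ ⊕ Fin m₂ → EuclideanSpace ℝ (Fin n) :=
  fun r => WithLp.toLp 2 (Matrix.fromRows A B r)

theorem feasible_eq_polyhedralCone_inter_closedBall (A : Matrix (Fin m₁) (Fin n) ℝ)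
    (B : Matrix (Fin m₂) (Fin n) ℝ) :
    feasible A B = polyhedralCone (constraintVec A B) ∩ Metric.closedBall 0 1 := by
  ext x
  simp [feasible, polyhedralCone, constraintVec, funext_iff, Matrix.mulVec, dotProduct,
    PiLp.inner_apply, mul_comm, and_assoc]

theorem fLp_eq_neg_inner_signVec_empty (x : EuclideanSpace ℝ (Fin n)) :
    fLp x = -⟪signVec ∅, x⟫ := by
  simp [fLp, signVec, sgn, PiLp.inner_apply]

theorem xiH_eq_neg_norm_nearestPoint (A : Matrix (Fin m₁) (Fin n) ℝ)
    (B : Matrix (Fin m₂) (Fin n) ℝ) :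
    xiH fLp A B = -‖nearestPoint (polyhedralCone (constraintVec A B)) (signVec ∅)‖ := by
  have hmax := isGreatest_norm_nearestPoint_polyhedralCone (constraintVec A B) (signVec ∅)
  rw [← feasible_eq_polyhedralCone_inter_closedBall] at hmax
  refine (isLeast_xiH A B).unique ⟨?_, ?_⟩
  · obtain ⟨x, hx, hval⟩ := hmax.1
    exact ⟨x, hx, by rw [fLp_eq_neg_inner_signVec_empty, ← hval]⟩
  · rintro _ ⟨x, hx, rfl⟩
    rw [fLp_eq_neg_inner_signVec_empty]
    exact neg_le_neg (hmax.2 ⟨x, hx, rfl⟩)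

theorem xiH_nonpos (A : Matrix (Fin m₁) (Fin n) ℝ) (B : Matrix (Fin m₂) (Fin n) ℝ) :
    xiH fLp A B ≤ 0 := by
  rw [xiH_eq_neg_norm_nearestPoint]
  exact neg_nonpos.2 (norm_nonneg _)

namespace IsIIDStdGaussian

variable {Ω : Type*} [MeasurableSpace Ω] {μ : Measure Ω}
  {A : Ω → Matrix (Fin m₁) (Fin n) ℝ} {B : Ω → Matrix (Fin m₂) (Fin n) ℝ} {δ : ℝ}

theorem hasLaw_constraintVec (h : IsIIDStdGaussian μ A B) :
    HasLaw (fun ω => constraintVec (A ω) (B ω))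
      (Measure.pi fun _ => stdGaussian (EuclideanSpace ℝ (Fin n))) μ :=
  hasLaw_rows_stdGaussian h.hasLaw h.indep

theorem measure_le_abs_sq_xiH_sub_max_le (h : IsIIDStdGaussian μ A B) (hδ : 0 < δ) :
    μ {ω | δ ≤ |xiH fLp (A ω) (B ω) ^ 2 - max 0 (n - (m₁ + m₂ / 2 : ℝ))|} ≤
      ENNReal.ofReal ((4 * n + m₂ / 2) / δ ^ 2) := by
  have hmeas := measurable_norm_nearestPoint_polyhedralCone (ι := Fin m₁) (κ := Fin m₂)
    (signVec (∅ : Finset (Fin n)))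
  simp only [xiH_eq_neg_norm_nearestPoint, neg_sq]
  rw [h.hasLaw_constraintVec.measure_eq (p := fun g => δ ≤
    |‖nearestPoint (polyhedralCone g) (signVec ∅)‖ ^ 2 - max 0 (n - (m₁ + m₂ / 2 : ℝ))|)
    (measurableSet_le measurable_const (by fun_prop))]
  simpa using measure_le_abs_sq_norm_nearestPoint_sub_max_le (Fin m₁) (Fin m₂) (Fin n) hδ

theorem measure_xiH_ne_zero_le (h : IsIIDStdGaussian μ A B) (hδ : 0 < δ)
    (hm : n + δ ≤ m₁ + m₂ / 2) :
    μ {ω | xiH fLp (A ω) (B ω) ≠ 0} ≤ ENNReal.ofReal ((m₂ / 4) / δ ^ 2) := by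
  simp only [xiH_eq_neg_norm_nearestPoint, neg_ne_zero]
  rw [h.hasLaw_constraintVec.measure_eq
    (p := fun g => ‖nearestPoint (polyhedralCone g) (signVec ∅)‖ ≠ 0)
    (measurable_norm_nearestPoint_polyhedralCone _ (measurableSet_singleton (0 : ℝ)).compl)]
  simpa using measure_nearestPoint_ne_zero_le (Fin m₁) (Fin m₂) (Fin n) hδ (by simpa)

end IsIIDStdGaussian

end OptimalValue

section ProbabilityToOne

variable {Ω : ℕ → Type*} [∀ n, MeasurableSpace (Ω n)] {μ : ∀ n, Measure (Ω n)}
  [∀ n, IsProbabilityMeasure (μ n)] {E F : ∀ n, Set (Ω n)}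

theorem tendsto_measure_one_of_compl_le {b : ℕ → ENNReal} (hb : Tendsto b atTop (𝓝 0))
    (h : ∀ᶠ n in atTop, μ n (E n)ᶜ ≤ b n) : Tendsto (fun n => μ n (E n)) atTop (𝓝 1) := by
  have hb' : Tendsto (fun n => 1 - b n) atTop (𝓝 1) := by
    simpa using ENNReal.Tendsto.sub tendsto_const_nhds hb (.inl ENNReal.one_ne_top)
  refine tendsto_of_tendsto_of_tendsto_of_le_of_le' hb' tendsto_const_nhds ?_
    (.of_forall fun n => prob_le_one)
  filter_upwards [h] with n hn
  rw [tsub_le_iff_right]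
  calc 1 = μ n (E n ∪ (E n)ᶜ) := by rw [Set.union_compl_self, measure_univ]
    _ ≤ μ n (E n) + μ n (E n)ᶜ := measure_union_le _ _
    _ ≤ μ n (E n) + b n := by gcongr

theorem tendsto_measure_one_mono (hE : Tendsto (fun n => μ n (E n)) atTop (𝓝 1))
    (h : ∀ᶠ n in atTop, E n ⊆ F n) : Tendsto (fun n => μ n (F n)) atTop (𝓝 1) :=
  tendsto_of_tendsto_of_tendsto_of_le_of_le' hE tendsto_const_nhds
    (h.mono fun _ hn => measure_mono hn) (.of_forall fun _ => prob_le_one)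

end ProbabilityToOne

section Asymptotics

theorem sq_sub_le_abs_sq_sub_sq {a c : ℝ} (ha : 0 ≤ a) (hc : 0 ≤ c) :
    (a - c) ^ 2 ≤ |a ^ 2 - c ^ 2| := by
  have hle : |a - c| ≤ |a + c| := by
    rw [abs_of_nonneg (add_nonneg ha hc), abs_le]
    constructor <;> linarith
  rw [sq_sub_sq, abs_mul, ← sq_abs (a - c), sq]
  exact mul_le_mul_of_nonneg_right hle (abs_nonneg _)

theorem tendsto_ofReal_div_sq_zero {u : ℕ → ℝ} {a : ℝ}
    (hu : Tendsto (fun n : ℕ => u n / n) atTop (𝓝 a)) (η : ℝ) :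
    Tendsto (fun n : ℕ => ENNReal.ofReal (u n / (η * n) ^ 2)) atTop (𝓝 0) := by
  have h := ENNReal.tendsto_ofReal
    ((hu.div_const (η ^ 2)).mul tendsto_one_div_atTop_nhds_zero_nat)
  rw [mul_zero, ENNReal.ofReal_zero] at h
  refine h.congr fun n => ?_
  congr 1
  ring

variable {α₁ α₂ : ℝ} {m₁ m₂ : ℕ → ℕ}

theorem tendsto_max_zero_sub_div (hm₁ : Tendsto (fun n : ℕ => (m₁ n : ℝ) / n) atTop (𝓝 α₁))
    (hm₂ : Tendsto (fun n : ℕ => (m₂ n : ℝ) / n) atTop (𝓝 α₂)) :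
    Tendsto (fun n : ℕ => max 0 (n - (m₁ n + m₂ n / 2 : ℝ)) / n) atTop
      (𝓝 (√(1 - (α₁ + α₂ / 2)) ^ 2)) := by
  rw [Real.sq_sqrt', max_comm]
  refine (tendsto_const_nhds.max ((hm₁.add (hm₂.div_const 2)).const_sub 1)).congr' ?_
  filter_upwards [eventually_ne_atTop 0] with n hn
  have hn' : (n : ℝ) ≠ 0 := Nat.cast_ne_zero.2 hn
  rw [← max_div_div_right n.cast_nonneg, zero_div]
  congr 1
  field_simp

variable {Ω : ℕ → Type*} [∀ n, MeasurableSpace (Ω n)] {μ : ∀ n, Measure (Ω n)}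
  [∀ n, IsProbabilityMeasure (μ n)]
  {A : ∀ n, Ω n → Matrix (Fin (m₁ n)) (Fin n) ℝ} {B : ∀ n, Ω n → Matrix (Fin (m₂ n)) (Fin n) ℝ}

theorem tendsto_measure_abs_xiH_add_le
    (hm₁ : Tendsto (fun n : ℕ => (m₁ n : ℝ) / n) atTop (𝓝 α₁))
    (hm₂ : Tendsto (fun n : ℕ => (m₂ n : ℝ) / n) atTop (𝓝 α₂))
    (hAB : ∀ n, IsIIDStdGaussian (μ n) (A n) (B n)) {δ : ℝ} (hδ : 0 < δ) :
    Tendsto (fun n => μ n {ω | |xiH fLp (A n ω) (B n ω) + √(1 - (α₁ + α₂ / 2)) * √n| ≤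
      δ * √n}) atTop (𝓝 1) := by
  set c := √(1 - (α₁ + α₂ / 2))
  have hbound : Tendsto (fun n : ℕ => (4 * n + m₂ n / 2 : ℝ) / n) atTop (𝓝 (4 + α₂ / 2)) := by
    refine ((hm₂.div_const 2).const_add 4).congr' ?_
    filter_upwards [eventually_ne_atTop 0] with n hn
    field_simp
  refine tendsto_measure_one_of_compl_le (tendsto_ofReal_div_sq_zero hbound (δ ^ 2 / 2)) ?_
  filter_upwards [eventually_gt_atTop 0, (tendsto_max_zero_sub_div hm₁ hm₂).eventually
    (Metric.closedBall_mem_nhds _ (half_pos (pow_pos hδ 2)))] with n hn hmax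
  have hn' : (0 : ℝ) < n := Nat.cast_pos.2 hn
  refine le_trans (measure_mono fun ω hω => ?_)
    ((hAB n).measure_le_abs_sq_xiH_sub_max_le (mul_pos (half_pos (pow_pos hδ 2)) hn'))
  set M := max 0 (n - (m₁ n + m₂ n / 2 : ℝ))
  set ξ := xiH fLp (A n ω) (B n ω)
  have hξ : δ ^ 2 * n < |ξ ^ 2 - c ^ 2 * n| := by
    have hgap : δ * √n < |-ξ - c * √n| := by
      rw [← abs_neg, neg_sub, sub_neg_eq_add, add_comm]
      exact not_le.1 hω
    calc δ ^ 2 * n = (δ * √n) ^ 2 := by rw [mul_pow, Real.sq_sqrt hn'.le]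
      _ < (-ξ - c * √n) ^ 2 := by rw [← sq_abs (-ξ - c * √n)]; gcongr
      _ ≤ |(-ξ) ^ 2 - (c * √n) ^ 2| :=
        sq_sub_le_abs_sq_sub_sq (neg_nonneg.2 (xiH_nonpos _ _)) (by positivity)
      _ = |ξ ^ 2 - c ^ 2 * n| := by rw [neg_sq, mul_pow, Real.sq_sqrt hn'.le]
  have hM : |M - c ^ 2 * n| ≤ δ ^ 2 / 2 * n := by
    change |M / n - c ^ 2| ≤ δ ^ 2 / 2 at hmax
    rw [div_sub' hn'.ne', abs_div, abs_of_pos hn',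
      div_le_iff₀ hn'] at hmax
    rwa [mul_comm (c ^ 2)]
  have htri := abs_sub_le (ξ ^ 2) M (c ^ 2 * n)
  change _ ≤ |ξ ^ 2 - M|
  linarith

theorem tendsto_measure_xiH_eq_zero
    (hm₁ : Tendsto (fun n : ℕ => (m₁ n : ℝ) / n) atTop (𝓝 α₁))
    (hm₂ : Tendsto (fun n : ℕ => (m₂ n : ℝ) / n) atTop (𝓝 α₂))
    (hAB : ∀ n, IsIIDStdGaussian (μ n) (A n) (B n)) (hα : 1 < α₁ + α₂ / 2) :
    Tendsto (fun n => μ n {ω | xiH fLp (A n ω) (B n ω) = 0}) atTop (𝓝 1) := by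
  obtain ⟨c, hc, hcα⟩ := exists_between hα
  have hbound : Tendsto (fun n : ℕ => (m₂ n / 4 : ℝ) / n) atTop (𝓝 (α₂ / 4)) := by
    simpa only [div_right_comm] using hm₂.div_const 4
  refine tendsto_measure_one_of_compl_le (tendsto_ofReal_div_sq_zero hbound (c - 1)) ?_
  filter_upwards [eventually_gt_atTop 0,
    (hm₁.add (hm₂.div_const 2)).eventually_const_lt hcα] with n hn hlt
  have hn' : (0 : ℝ) < n := Nat.cast_pos.2 hn
  refine (hAB n).measure_xiH_ne_zero_le (mul_pos (sub_pos.2 hc) hn') ?_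
  rw [div_right_comm, ← add_div, lt_div_iff₀ hn'] at hlt
  linarith

theorem tendsto_measure_xiH_mem_Ioo
    (hm₁ : Tendsto (fun n : ℕ => (m₁ n : ℝ) / n) atTop (𝓝 α₁))
    (hm₂ : Tendsto (fun n : ℕ => (m₂ n : ℝ) / n) atTop (𝓝 α₂))
    (hAB : ∀ n, IsIIDStdGaussian (μ n) (A n) (B n)) {a b : ℝ}
    (ha : a < √(1 - (α₁ + α₂ / 2))) (hb : √(1 - (α₁ + α₂ / 2)) < b) :
    Tendsto (fun n => μ n {ω | xiH fLp (A n ω) (B n ω) ∈ Set.Ioo (-b * √n) (-a * √n)}) atTop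
      (𝓝 1) := by
  obtain ⟨δ, hδ, hδ_lt⟩ := exists_between (lt_min (sub_pos.2 ha) (sub_pos.2 hb))
  obtain ⟨hδa, hδb⟩ := lt_min_iff.1 hδ_lt
  refine tendsto_measure_one_mono (tendsto_measure_abs_xiH_add_le hm₁ hm₂ hAB hδ) ?_
  filter_upwards [eventually_gt_atTop 0] with n hn ω hω
  have hn' : 0 < √(n : ℝ) := Real.sqrt_pos.2 (Nat.cast_pos.2 hn)
  rw [Set.mem_ofPred_eq, abs_le] at hω
  obtain ⟨hlo, hhi⟩ := hω
  constructor <;> nlinarith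

end Asymptotics

section Bounds

variable {ε₁ ε₅ α₁ α₂ : ℝ}

theorem xiDl_eq (ε₁ ε₅ α₁ α₂ : ℝ) (n : ℕ) :
    xiDl ε₁ ε₅ α₁ α₂ n = -√(1 - sqrtDl ε₁ ε₅ α₁ α₂ ^ 2) * √n := by
  unfold xiDl
  split_ifs with h
  · rfl
  · rw [Real.sqrt_eq_zero_of_nonpos (by linarith), neg_zero, zero_mul]

theorem xiDu_eq (ε₁ ε₅ α₁ α₂ : ℝ) (n : ℕ) :
    xiDu ε₁ ε₅ α₁ α₂ n = -√(1 - sqrtDu ε₁ ε₅ α₁ α₂ ^ 2) * √n := by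
  unfold xiDu
  split_ifs with h
  · rfl
  · rw [Real.sqrt_eq_zero_of_nonpos (by linarith), neg_zero, zero_mul]

theorem sqrtDl_sq_lt (hε₁ : 0 ≤ ε₁) (hε₅ : 0 < ε₅) (hl : 0 ≤ sqrtDl ε₁ ε₅ α₁ α₂) :
    sqrtDl ε₁ ε₅ α₁ α₂ ^ 2 < α₁ + α₂ / 2 := by
  rw [← Real.lt_sqrt hl, sqrtDl]
  linarith [mul_nonneg hε₁ (Real.sqrt_nonneg (α₁ + α₂ / 2))]

theorem lt_sqrtDu_sq (hε₁ : 0 ≤ ε₁) (hε₅ : 0 < ε₅) :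
    α₁ + α₂ / 2 < sqrtDu ε₁ ε₅ α₁ α₂ ^ 2 := by
  have hu : √(α₁ + α₂ / 2) < sqrtDu ε₁ ε₅ α₁ α₂ := by
    rw [sqrtDu]
    linarith [mul_nonneg hε₁ (Real.sqrt_nonneg (α₁ + α₂ / 2))]
  exact (Real.sqrt_lt' ((Real.sqrt_nonneg _).trans_lt hu)).1 hu

theorem xiDu_eq_zero (hε₁ : 0 ≤ ε₁) (hε₅ : 0 < ε₅) (hα : 1 ≤ α₁ + α₂ / 2) (n : ℕ) :
    xiDu ε₁ ε₅ α₁ α₂ n = 0 := by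
  have hu := lt_sqrtDu_sq (α₁ := α₁) (α₂ := α₂) hε₁ hε₅
  rw [xiDu_eq, Real.sqrt_eq_zero_of_nonpos (by linarith), neg_zero, zero_mul]

theorem sqrt_one_sub_lt_sqrt_one_sub_sqrtDl_sq (hε₁ : 0 ≤ ε₁) (hε₅ : 0 < ε₅)
    (hl : 0 ≤ sqrtDl ε₁ ε₅ α₁ α₂) (hl1 : sqrtDl ε₁ ε₅ α₁ α₂ < 1) :
    √(1 - (α₁ + α₂ / 2)) < √(1 - sqrtDl ε₁ ε₅ α₁ α₂ ^ 2) :=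
  (Real.sqrt_lt_sqrt_iff_of_pos (sub_pos.2 (pow_lt_one₀ hl hl1 two_ne_zero))).2
    (sub_lt_sub_left (sqrtDl_sq_lt hε₁ hε₅ hl) 1)

theorem sqrt_one_sub_sqrtDu_sq_lt_sqrt_one_sub (hε₁ : 0 ≤ ε₁) (hε₅ : 0 < ε₅)
    (hα : α₁ + α₂ / 2 < 1) :
    √(1 - sqrtDu ε₁ ε₅ α₁ α₂ ^ 2) < √(1 - (α₁ + α₂ / 2)) :=
  (Real.sqrt_lt_sqrt_iff_of_pos (sub_pos.2 hα)).2 (sub_lt_sub_left (lt_sqrtDu_sq hε₁ hε₅) 1)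

variable {m₁ m₂ : ℕ → ℕ} {Ω : ℕ → Type*} [∀ n, MeasurableSpace (Ω n)] {μ : ∀ n, Measure (Ω n)}
  [∀ n, IsProbabilityMeasure (μ n)]
  {A : ∀ n, Ω n → Matrix (Fin (m₁ n)) (Fin n) ℝ} {B : ∀ n, Ω n → Matrix (Fin (m₂ n)) (Fin n) ℝ}

theorem tendsto_measure_xiDl_lt_xiH_lt_xiDu
    (hm₁ : Tendsto (fun n : ℕ => (m₁ n : ℝ) / n) atTop (𝓝 α₁))
    (hm₂ : Tendsto (fun n : ℕ => (m₂ n : ℝ) / n) atTop (𝓝 α₂))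
    (hAB : ∀ n, IsIIDStdGaussian (μ n) (A n) (B n)) (hε₁ : 0 ≤ ε₁) (hε₅ : 0 < ε₅)
    (hl : 0 ≤ sqrtDl ε₁ ε₅ α₁ α₂) (hα : α₁ + α₂ / 2 < 1) :
    Tendsto (fun n => μ n {ω | xiDl ε₁ ε₅ α₁ α₂ n < xiH fLp (A n ω) (B n ω) ∧
      xiH fLp (A n ω) (B n ω) < xiDu ε₁ ε₅ α₁ α₂ n}) atTop (𝓝 1) := by
  have hl1 : sqrtDl ε₁ ε₅ α₁ α₂ < 1 :=
    (sq_lt_one_iff₀ hl).1 ((sqrtDl_sq_lt hε₁ hε₅ hl).trans hα)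
  simpa only [xiDl_eq, xiDu_eq, Set.mem_Ioo] using tendsto_measure_xiH_mem_Ioo hm₁ hm₂ hAB
    (sqrt_one_sub_sqrtDu_sq_lt_sqrt_one_sub hε₁ hε₅ hα)
    (sqrt_one_sub_lt_sqrt_one_sub_sqrtDl_sq hε₁ hε₅ hl hl1)

theorem tendsto_measure_xiDl_lt_xiH_le_xiDu
    (hm₁ : Tendsto (fun n : ℕ => (m₁ n : ℝ) / n) atTop (𝓝 α₁))
    (hm₂ : Tendsto (fun n : ℕ => (m₂ n : ℝ) / n) atTop (𝓝 α₂))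
    (hAB : ∀ n, IsIIDStdGaussian (μ n) (A n) (B n)) (hε₁ : 0 ≤ ε₁) (hε₅ : 0 < ε₅)
    (hl : 0 ≤ sqrtDl ε₁ ε₅ α₁ α₂) (hl1 : sqrtDl ε₁ ε₅ α₁ α₂ < 1) :
    Tendsto (fun n => μ n {ω | xiDl ε₁ ε₅ α₁ α₂ n < xiH fLp (A n ω) (B n ω) ∧
      xiH fLp (A n ω) (B n ω) ≤ xiDu ε₁ ε₅ α₁ α₂ n}) atTop (𝓝 1) := by
  rcases lt_or_ge (α₁ + α₂ / 2) 1 with hα | hα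
  · exact tendsto_measure_one_mono
      (tendsto_measure_xiDl_lt_xiH_lt_xiDu hm₁ hm₂ hAB hε₁ hε₅ hl hα)
      (.of_forall fun n ω hω => ⟨hω.1, hω.2.le⟩)
  · simp only [xiDu_eq_zero hε₁ hε₅ hα, xiH_nonpos, and_true, xiDl_eq]
    exact tendsto_measure_one_mono (tendsto_measure_xiH_mem_Ioo hm₁ hm₂ hAB
      (neg_one_lt_zero.trans_le (Real.sqrt_nonneg _))
      (sqrt_one_sub_lt_sqrt_one_sub_sqrtDl_sq hε₁ hε₅ hl hl1)) (.of_forall fun n ω hω => hω.1)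

theorem tendsto_measure_xiDl_le_xiH_le_xiDu
    (hm₁ : Tendsto (fun n : ℕ => (m₁ n : ℝ) / n) atTop (𝓝 α₁))
    (hm₂ : Tendsto (fun n : ℕ => (m₂ n : ℝ) / n) atTop (𝓝 α₂))
    (hAB : ∀ n, IsIIDStdGaussian (μ n) (A n) (B n)) (hε₁ : 0 ≤ ε₁) (hε₅ : 0 < ε₅)
    (hl : 0 ≤ sqrtDl ε₁ ε₅ α₁ α₂) :
    Tendsto (fun n => μ n {ω | xiDl ε₁ ε₅ α₁ α₂ n ≤ xiH fLp (A n ω) (B n ω) ∧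
      xiH fLp (A n ω) (B n ω) ≤ xiDu ε₁ ε₅ α₁ α₂ n}) atTop (𝓝 1) := by
  rcases lt_or_ge (sqrtDl ε₁ ε₅ α₁ α₂) 1 with hl1 | hl1
  · exact tendsto_measure_one_mono
      (tendsto_measure_xiDl_lt_xiH_le_xiDu hm₁ hm₂ hAB hε₁ hε₅ hl hl1)
      (.of_forall fun n ω hω => ⟨hω.1.le, hω.2⟩)
  · have hl_sq : 1 ≤ sqrtDl ε₁ ε₅ α₁ α₂ ^ 2 := one_le_pow₀ hl1
    have hα : 1 < α₁ + α₂ / 2 := hl_sq.trans_lt (sqrtDl_sq_lt hε₁ hε₅ hl)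
    have hxiDl (n : ℕ) : xiDl ε₁ ε₅ α₁ α₂ n = 0 := by
      rw [xiDl_eq, Real.sqrt_eq_zero_of_nonpos (sub_nonpos.2 hl_sq), neg_zero, zero_mul]
    simp only [hxiDl, xiDu_eq_zero hε₁ hε₅ hα.le]
    exact tendsto_measure_one_mono (tendsto_measure_xiH_eq_zero hm₁ hm₂ hAB hα)
      (.of_forall fun n ω hω => ⟨ge_of_eq hω, le_of_eq hω⟩)

end Bounds

end RandomLinearProgram

end

open RandomLinearProgram in
theorem mainTheorem3 {α₁ α₂ : ℝ} {m₁ m₂ : ℕ → ℕ}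
    (hm₁ : Tendsto (fun n : ℕ => (m₁ n : ℝ) / n) atTop (𝓝 α₁))
    (hm₂ : Tendsto (fun n : ℕ => (m₂ n : ℝ) / n) atTop (𝓝 α₂))
    {Ω : ℕ → Type*} [∀ n, MeasurableSpace (Ω n)]
    (μ : ∀ n, Measure (Ω n)) [∀ n, IsProbabilityMeasure (μ n)]
    (A : ∀ n, Ω n → Matrix (Fin (m₁ n)) (Fin n) ℝ)
    (B : ∀ n, Ω n → Matrix (Fin (m₂ n)) (Fin n) ℝ)
    (hAB : ∀ n, IsIIDStdGaussian (μ n) (A n) (B n)) :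
    (∀ ε₁ ε₅ : ℝ, 0 < ε₁ → 0 < ε₅ → 0 ≤ sqrtDl ε₁ ε₅ α₁ α₂ →
      (α₁ + α₂ / 2 < 1 →
        Tendsto (fun n => μ n {ω | xiDl ε₁ ε₅ α₁ α₂ n < xiH fLp (A n ω) (B n ω) ∧
          xiH fLp (A n ω) (B n ω) < xiDu ε₁ ε₅ α₁ α₂ n}) atTop (𝓝 1)) ∧
      (sqrtDl ε₁ ε₅ α₁ α₂ < 1 →
        Tendsto (fun n => μ n {ω | xiDl ε₁ ε₅ α₁ α₂ n < xiH fLp (A n ω) (B n ω) ∧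
          xiH fLp (A n ω) (B n ω) ≤ xiDu ε₁ ε₅ α₁ α₂ n}) atTop (𝓝 1)) ∧
      Tendsto (fun n => μ n {ω | xiDl ε₁ ε₅ α₁ α₂ n ≤ xiH fLp (A n ω) (B n ω) ∧
        xiH fLp (A n ω) (B n ω) ≤ xiDu ε₁ ε₅ α₁ α₂ n}) atTop (𝓝 1)) ∧
    (α₁ + α₂ / 2 < 1 → ∀ δ : ℝ, 0 < δ →
      Tendsto (fun n => μ n {ω | |xiH fLp (A n ω) (B n ω) -
        (-√(1 - α₁ - α₂ / 2) * √(n : ℝ))| ≤ δ * √(n : ℝ)}) atTop (𝓝 1)) ∧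
    (1 ≤ α₁ + α₂ / 2 → ∀ δ : ℝ, 0 < δ →
      Tendsto (fun n => μ n {ω | |xiH fLp (A n ω) (B n ω)| ≤ δ * √(n : ℝ)}) atTop (𝓝 1)) ∧
    (1 < α₁ + α₂ / 2 →
      Tendsto (fun n => μ n {ω | xiH fLp (A n ω) (B n ω) = 0}) atTop (𝓝 1)) := by
  refine ⟨fun ε₁ ε₅ hε₁ hε₅ hl =>
    ⟨tendsto_measure_xiDl_lt_xiH_lt_xiDu hm₁ hm₂ hAB hε₁.le hε₅ hl,
      tendsto_measure_xiDl_lt_xiH_le_xiDu hm₁ hm₂ hAB hε₁.le hε₅ hl,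
      tendsto_measure_xiDl_le_xiH_le_xiDu hm₁ hm₂ hAB hε₁.le hε₅ hl⟩,
    fun _ δ hδ => ?_, fun hα δ hδ => ?_, tendsto_measure_xiH_eq_zero hm₁ hm₂ hAB⟩
  · simpa only [neg_mul, sub_neg_eq_add, sub_sub] using
      tendsto_measure_abs_xiH_add_le hm₁ hm₂ hAB hδ
  · have hlim := tendsto_measure_abs_xiH_add_le hm₁ hm₂ hAB hδ
    simpa only [Real.sqrt_eq_zero_of_nonpos (sub_nonpos.2 hα), zero_mul, add_zero] using hlim
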